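/- Let $p$ be a prime and let $\Sigma_p=\{0,1,\dots,p-1\}$ with its natural order. A \emph{necklace} $[w]$ over $\Sigma_p$ is the class of a word $w$ under rotation; its length is the length of $w$, and its \emph{weight} is the sum $\sum_j w_j$ of the letters of $w$. It is \emph{aperiodic} if $w$ is primitive, i.e. $w=v^m$ with $v$ a nonempty word implies $m=1$. The \emph{Burrows--Wheeler matrix} of a necklace $[w]$ of length $n$ is the $n\times n$ matrix whose rows are the $n$ rotations of $w$ (with multiplicity) in ascending lexicographic order, and $[w]$ is \emph{invertible} if the determinant of this matrix is nonzero modulo $p$. A prime $q$ is \emph{$p$-rooted} if $p$ is (modulo $q$) a generator of the cyclic group $\mathbb{F}_q^*$. Let $n$ be a positive integer. Then every aperiodic necklace of length $n$ over $\Sigma_p$ whose weight is nonzero modulo $p$ is invertible if and only if $n$ is a power of $p$ (that is, $n=p^k$ for some integer $k\ge 0$) or $n$ is a $p$-rooted prime. -/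

import Mathlib

/-- A necklace (circular word) over the sorted alphabet `{0, 1, …, k - 1}`: a conjugacy class of
words, that is, a word up to rotation. -/
abbrev Necklace (k : ℕ) : Type := Cycle (Fin k)

/-- A word `w` is primitive if `w = v ^ m` (concatenation of `m` copies of `v`), with `v` nonempty,
implies `m = 1`. -/
def IsPrimitiveWord {k : ℕ} (w : List (Fin k)) : Prop :=
  ∀ (v : List (Fin k)) (m : ℕ), v ≠ [] → w = (List.replicate m v).flatten → m = 1

namespace Necklace

/-- An aperiodic necklace is a conjugacy class of primitive words. -/
def IsAperiodic {k : ℕ} (c : Necklace k) : Prop :=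
  ∀ w : List (Fin k), (w : Cycle (Fin k)) = c → IsPrimitiveWord w

/-- The weight of a necklace: the sum of its letters, as a natural number. -/
def weight {k : ℕ} (c : Necklace k) : ℕ :=
  (c.toMultiset.map (fun a : Fin k => (a : ℕ))).sum

/-- The shifts of a necklace, counted with multiplicity, in ascending lexicographic order. -/
def bwtRows {k : ℕ} (c : Necklace k) : List (List (Fin k)) :=
  c.lists.sort (· ≤ ·)

theorem length_bwtRows {k : ℕ} (c : Necklace k) (h : 0 < c.length) :
    c.bwtRows.length = c.length := by
  induction c using Quotient.inductionOn' with
  | h l =>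
    have hl : l ≠ [] := by
      rintro rfl
      exact absurd h (Nat.lt_irrefl 0)
    simp only [bwtRows, Multiset.length_sort]
    exact List.length_cyclicPermutations_of_ne_nil l hl

theorem length_of_mem_bwtRows {k : ℕ} (c : Necklace k) {r : List (Fin k)} (h : r ∈ c.bwtRows) :
    r.length = c.length := by
  have h' : r ∈ c.lists := (Multiset.mem_sort (· ≤ ·)).1 h
  rw [← Cycle.mem_lists_iff_coe_eq.1 h']
  rfl

/-- The Burrows–Wheeler matrix of a necklace: the square matrix whose rows are the shifts of the
necklace in ascending lexicographic order. -/
def bwtMatrix {k : ℕ} (c : Necklace k) : Matrix (Fin c.length) (Fin c.length) ℕ :=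
  fun i j =>
    have hi : (i : ℕ) < c.bwtRows.length :=
      (c.length_bwtRows i.pos).symm ▸ i.isLt
    have hj : (j : ℕ) < (c.bwtRows[(i : ℕ)]'hi).length :=
      (c.length_of_mem_bwtRows (List.getElem_mem hi)).symm ▸ j.isLt
    (((c.bwtRows[(i : ℕ)]'hi)[(j : ℕ)]'hj : Fin k) : ℕ)

/-- A necklace over `{0, 1, …, p - 1}` is invertible if its Burrows–Wheeler matrix has nonzero
determinant modulo `p`. -/
def IsInvertible {p : ℕ} (c : Necklace p) : Prop :=
  (c.bwtMatrix.map (fun a : ℕ => (a : ZMod p))).det ≠ 0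

end Necklace

/-- A prime `q` is `p`-rooted if (the residue class of) `p` generates the multiplicative group of
the field with `q` elements. -/
def IsRootedPrime (p q : ℕ) : Prop :=
  q.Prime ∧ ∃ u : (ZMod q)ˣ, (u : ZMod q) = (p : ZMod q) ∧ ∀ x : (ZMod q)ˣ, x ∈ Subgroup.zpowers u

/-! ### Words as polynomials modulo `X ^ n - 1`. -/

open Polynomial

/-! Up to the order of rows, the matrix consists of all rotations of the word. With `W` the
polynomial whose coefficients are the letters, it is nonsingular when `W` is coprime to `X ^ n - 1`
and singular when they share a nonconstant factor; nonzero weight says `W(1) ≠ 0`.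

If `n = p ^ k`, then `X ^ n - 1 = (X - 1) ^ n` and coprimality is immediate. If `n = q` is
`p`-rooted, the only other factor is the irreducible `Φ_q`, and a word divisible by it is constant,
hence not primitive.

Otherwise `n` has a prime factor `q ≠ p`. If `q < n`, the coefficients of `Φ_q`, i.e. `1^q 0^(n-q)`,
give a counterexample. If `q = n`, then `Φ_q` is reducible and a proper factor does. -/

/-- The cyclic shift of functions on `Fin n`. -/
def cyclicShift (R : Type*) [CommSemiring R] (n : ℕ) [NeZero n] : Module.End R (Fin n → R) :=
  LinearMap.funLeft R R (fun i => i + 1)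

theorem cyclicShift_pow_apply {R : Type*} [CommSemiring R] {n : ℕ} [NeZero n] (m : ℕ)
    (v : Fin n → R) (i : Fin n) : (cyclicShift R n ^ m) v i = v (i + Fin.ofNat n m) := by
  induction m generalizing v with
  | zero => simp [Fin.ofNat]
  | succ m ih =>
    rw [pow_succ, Module.End.mul_apply, ih]
    simp only [cyclicShift, LinearMap.funLeft_apply, add_assoc]
    congr 2
    ext
    simp [Fin.val_add]

theorem cyclicShift_pow_self {R : Type*} [CommSemiring R] {n : ℕ} [NeZero n] :
    cyclicShift R n ^ n = 1 := by
  refine LinearMap.ext fun v => funext fun i => ?_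
  simp [cyclicShift_pow_apply]

/-- The polynomial of degree less than `n` with prescribed coefficients. -/
noncomputable def polyOfCoeffs {R : Type*} [CommSemiring R] {n : ℕ} (a : Fin n → R) : R[X] :=
  ∑ i, C (a i) * X ^ (i : ℕ)

theorem polyOfCoeffs_coeff {R : Type*} [CommSemiring R] {n : ℕ} (a : Fin n → R) (i : Fin n) :
    (polyOfCoeffs a).coeff i = a i := by
  simp [polyOfCoeffs, coeff_C_mul, coeff_X_pow, Fin.val_inj]

theorem degree_polyOfCoeffs_lt {R : Type*} [CommSemiring R] {n : ℕ} (a : Fin n → R) :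
    (polyOfCoeffs a).degree < n := by
  rw [polyOfCoeffs]
  refine (degree_sum_le _ _).trans_lt ?_
  refine (Finset.sup_lt_iff (WithBot.bot_lt_coe n)).2 fun i _ => ?_
  exact (degree_C_mul_X_pow_le _ _).trans_lt (Nat.cast_lt.2 i.isLt)

theorem polyOfCoeffs_of_coeff {R : Type*} [CommSemiring R] {n : ℕ} (g : R[X])
    (hg : g.natDegree < n) : polyOfCoeffs (fun i : Fin n => g.coeff i) = g := by
  rw [polyOfCoeffs, Fin.sum_univ_eq_sum_range (fun i => C (g.coeff i) * X ^ i) n]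
  exact (g.as_sum_range_C_mul_X_pow' hg).symm

/-- Evaluate a Bézout identity at the cyclic shift `S`: both `W(S) v` and `S ^ n - 1` vanish, which
leaves `v = 0`. -/
theorem eq_zero_of_isCoprime_of_rotations {F : Type*} [Field F] {n : ℕ} [NeZero n]
    {a v : Fin n → F} (hcop : IsCoprime (polyOfCoeffs a) (X ^ n - 1))
    (h : ∀ k, ∑ j, a (j + k) * v j = 0) : v = 0 := by
  have hW : aeval (cyclicShift F n) (polyOfCoeffs a) v = 0 := by
    ext m
    -- Entry `m` of `W(S) v` is `∑ a i * v (m + i)`; putting `j = m + i` turns it into the rotation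
    -- sum at `-m`.
    refine Eq.trans ?_ (h (-m))
    simp only [polyOfCoeffs, map_sum, map_mul, aeval_C, map_pow, aeval_X, LinearMap.sum_apply,
      Finset.sum_apply, Module.End.mul_apply, Module.algebraMap_end_apply, Pi.smul_apply,
      cyclicShift_pow_apply, smul_eq_mul, Fin.ofNat_val_eq_self]
    exact Fintype.sum_equiv (Equiv.addLeft m) _ _ fun i => by simp
  obtain ⟨r, s, hrs⟩ := hcop
  have := congrArg (fun q => aeval (cyclicShift F n) q v) hrs
  simpa [hW, cyclicShift_pow_self] using this.symm

/-- Multiplied by `ζ ^ k`, the sum reindexes to `W(ζ)`, because exponents of `ζ` only matter modulo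
`n`. -/
theorem sum_rotation_mul_pow_eq_zero {K : Type*} [Field K] {n : ℕ} [NeZero n] {a : Fin n → K}
    {ζ : K} (hζ : ζ ^ n = 1) (h : (polyOfCoeffs a).eval ζ = 0) (k : Fin n) :
    ∑ j, a (j + k) * ζ ^ (j : ℕ) = 0 := by
  have hζ0 : ζ ≠ 0 := by
    rintro rfl
    simp [zero_pow (NeZero.ne n)] at hζ
  refine (mul_eq_zero.1 ?_).resolve_left (pow_ne_zero (k : ℕ) hζ0)
  rw [← h, polyOfCoeffs, eval_finsetSum, Finset.mul_sum]
  refine Fintype.sum_equiv (Equiv.addRight k) _ _ fun j => ?_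
  simp only [eval_mul, eval_C, eval_pow, eval_X, Equiv.coe_addRight, Fin.val_add]
  rw [← pow_eq_pow_mod _ hζ, pow_add]
  ring

/-! ### Singularity, weight and aperiodicity in terms of the word. -/

namespace Necklace

/-- The kernel depends only on the set of rows, so sorting is irrelevant. A general field `K` allows
kernel vectors over an algebraic closure. -/
theorem bwtMatrix_map_det_eq_zero_iff {K : Type*} [Field K] {k n : ℕ} [NeZero n]
    (f : Fin n → Fin k) :
    ((bwtMatrix ((List.ofFn f : List (Fin k)) : Necklace k)).map (fun a : ℕ => (a : K))).det = 0 ↔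
      ∃ v : Fin n → K, v ≠ 0 ∧ ∀ m : Fin n, ∑ j, ((f (j + m) : ℕ) : K) * v j = 0 := by
  suffices H : ∀ (w : List (Fin k)) (hw : w.length = n),
      ((bwtMatrix (w : Necklace k)).map (fun a : ℕ => (a : K))).det = 0 ↔
        ∃ v : Fin n → K, v ≠ 0 ∧
          ∀ m : Fin n, ∑ j, ((w[(j + m : Fin n)]'(by rw [hw]; exact Fin.isLt _) : ℕ) : K) * v j = 0 by
    rw [H (List.ofFn f) List.length_ofFn]
    simp
  intro w hw
  subst hw
  rw [← Matrix.exists_mulVec_eq_zero_iff]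
  refine exists_congr fun v => and_congr_right fun _ => ?_
  have hpos : 0 < w.length := Nat.pos_of_ne_zero (NeZero.ne _)
  have hrows : (bwtRows (w : Necklace k)).length = w.length := length_bwtRows (w : Necklace k) hpos
  have hrow : ∀ r : List (Fin k), r ∈ bwtRows (w : Necklace k) ↔ ∃ m : Fin w.length, w.rotate m = r := by
    intro r
    rw [bwtRows, Multiset.mem_sort, Cycle.mem_lists_iff_coe_eq, Cycle.coe_eq_coe]
    constructor
    · intro h
      obtain ⟨m, hm⟩ := h.symm
      exact ⟨⟨m % w.length, Nat.mod_lt _ hpos⟩, by rw [List.rotate_mod, hm]⟩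
    · rintro ⟨m, rfl⟩
      exact List.IsRotated.symm ⟨m, rfl⟩
  -- `getD` carries no bound proof, so a row can be rewritten as a rotation; the default 0 is never
  -- reached.
  have key : ∀ i, (((bwtMatrix (w : Necklace k)).map (fun a : ℕ => (a : K))).mulVec v) i = 0 ↔
      ∑ j : Fin w.length, (((((bwtRows (w : Necklace k))[(i : ℕ)]'(by
        rw [hrows]; exact i.isLt)).map Fin.val).getD j 0 : ℕ) : K) * v j = 0 := by
    intro i
    simp only [Matrix.mulVec, dotProduct, Matrix.map_apply, bwtMatrix]
    refine Eq.congr_left (Finset.sum_congr rfl fun j _ => ?_)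
    congr 2
    rw [List.getD_eq_getElem _ _ (by
      rw [List.length_map, length_of_mem_bwtRows _ (List.getElem_mem _)]; exact j.isLt)]
    simp
  have rot : ∀ m : Fin w.length, (∑ j : Fin w.length,
      (((w.rotate m).map Fin.val).getD j 0 : K) * v j = 0) ↔
      ∑ j, ((w[(j + m : Fin w.length)] : ℕ) : K) * v j = 0 := by
    intro m
    refine Eq.congr_left (Finset.sum_congr rfl fun j _ => ?_)
    congr 2
    rw [List.getD_eq_getElem _ _ (by simp)]
    simp [List.getElem_rotate, Fin.val_add]
  rw [funext_iff]
  simp only [Pi.zero_apply, key, ← rot]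
  constructor
  · intro h m
    obtain ⟨i, hi, hr⟩ := List.getElem_of_mem ((hrow _).2 ⟨m, rfl⟩)
    rw [← hr]
    exact h ⟨i, by rw [hrows] at hi; exact hi⟩
  · intro h i
    obtain ⟨m, hm⟩ := (hrow _).1 (List.getElem_mem (l := bwtRows (w : Necklace k)) (n := i) (by
        rw [hrows]; exact i.isLt))
    rw [← hm]
    exact h m

theorem isInvertible_of_isCoprime {p n : ℕ} [Fact p.Prime] [NeZero n] {f : Fin n → Fin p}
    (h : IsCoprime (polyOfCoeffs fun i => ((f i : ℕ) : ZMod p)) (X ^ n - 1)) :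
    IsInvertible ((List.ofFn f : List (Fin p)) : Necklace p) := by
  intro h0
  obtain ⟨v, hv, hk⟩ := (bwtMatrix_map_det_eq_zero_iff f).1 h0
  exact hv (eq_zero_of_isCoprime_of_rotations h hk)

/-- A root `ζ` of `g` in the algebraic closure yields the kernel vector `(ζ ^ j)`; the vanishing
determinant descends to `ZMod p`. -/
theorem not_isInvertible_of_dvd {p n : ℕ} [Fact p.Prime] [NeZero n] {f : Fin n → Fin p}
    {g : (ZMod p)[X]} (hg : g.degree ≠ 0) (hgf : g ∣ polyOfCoeffs fun i => ((f i : ℕ) : ZMod p))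
    (hgn : g ∣ X ^ n - 1) :
    ¬ IsInvertible ((List.ofFn f : List (Fin p)) : Necklace p) := by
  let K := AlgebraicClosure (ZMod p)
  obtain ⟨ζ, hζ⟩ := IsAlgClosed.exists_aeval_eq_zero K g hg
  have hn : ζ ^ n = 1 := by
    have := aeval_eq_zero_of_dvd_aeval_eq_zero hgn hζ
    simpa [sub_eq_zero] using this
  have hf := aeval_eq_zero_of_dvd_aeval_eq_zero hgf hζ
  have hdet : ((bwtMatrix ((List.ofFn f : List (Fin p)) : Necklace p)).map
      (fun a : ℕ => (a : K))).det = 0 := by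
    refine (bwtMatrix_map_det_eq_zero_iff f).2 ⟨fun j => ζ ^ (j : ℕ), ?_, fun m => ?_⟩
    · intro h
      simpa using congrFun h 0
    · refine sum_rotation_mul_pow_eq_zero (a := fun j => ((f j : ℕ) : K)) hn ?_ m
      simpa [polyOfCoeffs, eval_finsetSum] using hf
  intro h
  apply h
  apply (algebraMap (ZMod p) K).injective
  rw [RingHom.map_det, map_zero]
  refine Eq.trans (congrArg Matrix.det ?_) hdet
  ext i j
  exact map_natCast (algebraMap (ZMod p) K) _

theorem weight_ofFn {k n : ℕ} (f : Fin n → Fin k) :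
    weight ((List.ofFn f : List (Fin k)) : Necklace k) = ∑ i, (f i : ℕ) := by
  simp [weight, List.map_ofFn, List.sum_ofFn]

theorem weight_ofFn_modEq_zero_iff {p n : ℕ} (f : Fin n → Fin p) :
    weight ((List.ofFn f : List (Fin p)) : Necklace p) ≡ 0 [MOD p] ↔
      (polyOfCoeffs fun i => ((f i : ℕ) : ZMod p)).eval 1 = 0 := by
  rw [weight_ofFn, ← ZMod.natCast_eq_natCast_iff]
  simp [polyOfCoeffs, eval_finsetSum]

/-- If some rotation is `v ^ m`, rotating by the length of `v` fixes it, and therefore fixes the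
original word too. -/
theorem isAperiodic_of_forall_dvd {k n : ℕ} [NeZero n] {f : Fin n → Fin k}
    (h : ∀ d, d ∣ n → (∀ i, f (i + Fin.ofNat n d) = f i) → d = n) :
    IsAperiodic ((List.ofFn f : List (Fin k)) : Necklace k) := by
  intro w hw v m hv hm
  have hn : 0 < n := Nat.pos_of_ne_zero (NeZero.ne n)
  rw [Cycle.coe_eq_coe] at hw
  have hlen : m * v.length = n := by
    have := hw.perm.length_eq
    rw [hm] at this
    simpa using this
  have hvl : 0 < v.length := List.length_pos_iff.2 hv
  have hwr : w.rotate v.length = w := by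
    obtain _ | m := m
    · simp at hlen; omega
    · subst hm
      rw [List.replicate_succ, List.flatten_cons, List.rotate_append_length_eq]
      rw [← List.flatten_singleton (l := v), ← List.flatten_append]
      simp [← List.replicate_succ', List.replicate_succ]
  obtain ⟨s, hs⟩ := hw
  have hfr : (List.ofFn f).rotate v.length = List.ofFn f := by
    rw [← hs, List.rotate_rotate, add_comm, ← List.rotate_rotate, hwr]
  have := h v.length ⟨m, by rw [← hlen, mul_comm]⟩ fun i => by
    have h1 := List.getElem_of_eq hfr (i := i) (by simp)
    rw [List.getElem_rotate] at h1
    simp only [List.getElem_ofFn, List.length_ofFn] at h1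
    rw [show f i = f ⟨i, i.isLt⟩ from rfl, ← h1]
    congr 1
    ext
    simp [Fin.val_add]
  rw [this] at hlen
  exact Nat.eq_of_mul_eq_mul_right hn (by simpa using hlen)

end Necklace

/-! ### Factors of `X ^ n - 1` modulo `p`. -/

theorem isCoprime_X_pow_prime_pow_sub_one {p : ℕ} [Fact p.Prime] (k : ℕ) {W : (ZMod p)[X]}
    (hW : W.eval 1 ≠ 0) : IsCoprime W (X ^ p ^ k - 1) := by
  have : (X ^ p ^ k - 1 : (ZMod p)[X]) = (X - C 1) ^ p ^ k := by
    rw [sub_pow_char_pow]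
    simp
  rw [this]
  refine (IsCoprime.pow_left ?_).symm
  refine (dvd_or_isCoprime _ _ (irreducible_X_sub_C (1 : ZMod p))).resolve_left ?_
  rwa [dvd_iff_isRoot]

/-- Irreducible factors of `Φ_q` have degree the order of `p` modulo `q`, here `q - 1`, the degree
of `Φ_q`. -/
theorem IsRootedPrime.irreducible_cyclotomic {p q : ℕ} [Fact p.Prime] (h : IsRootedPrime p q) :
    Irreducible (cyclotomic q (ZMod p)) := by
  obtain ⟨hq, u, hu, hgen⟩ := h
  have : Fact q.Prime := ⟨hq⟩
  have hpq : ¬ p ∣ q := by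
    intro hd
    rw [(Nat.prime_dvd_prime_iff_eq Fact.out hq).1 hd, ZMod.natCast_self] at hu
    exact u.ne_zero hu
  refine ZMod.irreducible_of_dvd_cyclotomic_of_natDegree hpq dvd_rfl ?_
  rw [natDegree_cyclotomic, Nat.totient_prime hq]
  have : ZMod.unitOfCoprime p ((Fact.out : p.Prime).coprime_iff_not_dvd.mpr hpq) = u :=
    Units.ext (by simp [hu])
  rw [this, orderOf_eq_card_of_forall_mem_zpowers hgen, Nat.card_eq_fintype_card, ZMod.card_units]

theorem isRootedPrime_of_irreducible_cyclotomic {p q : ℕ} [Fact p.Prime] (hq : q.Prime)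
    (hpq : ¬ p ∣ q) (h : Irreducible (cyclotomic q (ZMod p))) : IsRootedPrime p q := by
  have : Fact q.Prime := ⟨hq⟩
  have hcop := (Fact.out : p.Prime).coprime_iff_not_dvd.mpr hpq
  refine ⟨hq, ZMod.unitOfCoprime p hcop, by simp, fun x => ?_⟩
  have hd := natDegree_of_dvd_cyclotomic_of_irreducible (K := ZMod p) (p := p) (f := 1) (n := q)
    (by simp) (by simpa using hcop) dvd_rfl h
  rw [natDegree_cyclotomic, Nat.totient_prime hq] at hd
  have ho : orderOf (ZMod.unitOfCoprime p hcop) = Nat.card (ZMod q)ˣ := by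
    rw [Nat.card_eq_fintype_card, ZMod.card_units, hd]
    congr 1
    ext
    simp
  rw [Subgroup.eq_top_of_card_eq _ ((Nat.card_zpowers _).trans ho)]
  exact Subgroup.mem_top x

/-! ### Necklaces built from factors, and the two directions. -/

/-- The word over `Fin p` formed by the first `n` coefficients of a polynomial over `ZMod p`. -/
def coeffWord {p : ℕ} [Fact p.Prime] (n : ℕ) (g : (ZMod p)[X]) (i : Fin n) : Fin p :=
  ⟨(g.coeff i).val, ZMod.val_lt _⟩

theorem cast_coeffWord {p n : ℕ} [Fact p.Prime] (g : (ZMod p)[X]) (i : Fin n) :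
    ((coeffWord n g i : ℕ) : ZMod p) = g.coeff i := by
  simp [coeffWord]

theorem coeffWord_eq_iff {p n : ℕ} [Fact p.Prime] (g : (ZMod p)[X]) (i j : Fin n) :
    coeffWord n g i = coeffWord n g j ↔ g.coeff i = g.coeff j := by
  rw [coeffWord, coeffWord, Fin.mk.injEq]
  exact (ZMod.val_injective p).eq_iff

theorem polyOfCoeffs_coeffWord {p n : ℕ} [Fact p.Prime] {g : (ZMod p)[X]} (hg : g.natDegree < n) :
    (polyOfCoeffs fun i => ((coeffWord n g i : ℕ) : ZMod p)) = g := by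
  simp only [cast_coeffWord]
  exact polyOfCoeffs_of_coeff g hg

namespace Necklace

theorem exists_not_isInvertible_of_dvd {p n : ℕ} [Fact p.Prime] [NeZero n] {g : (ZMod p)[X]}
    (hg : g.natDegree < n) (hg0 : g.degree ≠ 0) (hg1 : g.eval 1 ≠ 0) (hgn : g ∣ X ^ n - 1)
    (hper : ∀ d, d ∣ n → (∀ i : Fin n, g.coeff (i + Fin.ofNat n d : Fin n) = g.coeff i) → d = n) :
    ∃ c : Necklace p, c.length = n ∧ c.IsAperiodic ∧ ¬ c.weight ≡ 0 [MOD p] ∧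
      ¬ c.IsInvertible := by
  have hp := polyOfCoeffs_coeffWord hg
  refine ⟨((List.ofFn (coeffWord n g) : List (Fin p)) : Necklace p), by simp, ?_, ?_, ?_⟩
  · refine isAperiodic_of_forall_dvd fun d hd h => hper d hd fun i => ?_
    exact (coeffWord_eq_iff _ _ _).1 (h i)
  · rwa [weight_ofFn_modEq_zero_iff, hp]
  · exact not_isInvertible_of_dvd hg0 (by rw [hp]) hgn

theorem isInvertible_of_isRootedPrime {p q : ℕ} [Fact p.Prime] [NeZero q] (h : IsRootedPrime p q)
    {f : Fin q → Fin p} (hf : IsAperiodic ((List.ofFn f : List (Fin p)) : Necklace p))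
    (hw : ¬ weight ((List.ofFn f : List (Fin p)) : Necklace p) ≡ 0 [MOD p]) :
    IsInvertible ((List.ofFn f : List (Fin p)) : Necklace p) := by
  have : Fact q.Prime := ⟨h.1⟩
  have hirr := h.irreducible_cyclotomic
  rw [weight_ofFn_modEq_zero_iff] at hw
  apply isInvertible_of_isCoprime
  rw [← cyclotomic_prime_mul_X_sub_one]
  refine IsCoprime.mul_right ?_ ?_
  · refine ((dvd_or_isCoprime _ _ hirr).resolve_left ?_).symm
    intro hd
    obtain ⟨r, hr⟩ := hd
    have hr0 : r.natDegree = 0 := by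
      by_contra hne
      have hr' : r ≠ 0 := by
        rintro rfl
        simp at hne
      have hdeg := natDegree_mul hirr.ne_zero hr'
      rw [← hr, natDegree_cyclotomic, Nat.totient_prime h.1] at hdeg
      -- The word polynomial has degree below `q` and `Φ_q` has degree `q - 1`, so the cofactor is
      -- constant.
      have hlt := (natDegree_lt_iff_degree_lt (by rw [hr]; exact mul_ne_zero hirr.ne_zero hr')).2
        (degree_polyOfCoeffs_lt fun i => ((f i : ℕ) : ZMod p))
      omega
    rw [natDegree_eq_zero] at hr0
    obtain ⟨a, rfl⟩ := hr0
    have hcoeff : ∀ i, ((f i : ℕ) : ZMod p) = a := fun i => by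
      rw [← polyOfCoeffs_coeff (fun i => ((f i : ℕ) : ZMod p)) i, hr, coeff_mul_C, cyclotomic_prime,
        finsetSum_coeff]
      simp [coeff_X_pow]
    have hconst : ∀ i, f i = f 0 := fun i => by
      have := (hcoeff i).trans (hcoeff 0).symm
      rw [ZMod.natCast_eq_natCast_iff'] at this
      rwa [Nat.mod_eq_of_lt (f i).isLt, Nat.mod_eq_of_lt (f 0).isLt, Fin.val_inj] at this
    -- A constant word is the `q`-th power of a letter, so primitivity would force `q = 1`.
    refine h.1.one_lt.ne' (hf _ rfl [f 0] q (by simp) ?_)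
    rw [funext hconst]
    simp [List.ofFn_const]
  · rw [← C_1]
    exact ((dvd_or_isCoprime _ _ (irreducible_X_sub_C (1 : ZMod p))).resolve_left
      (by rwa [dvd_iff_isRoot])).symm

theorem exists_not_isInvertible_of_prime {p q : ℕ} [Fact p.Prime] (hq : q.Prime) (hpq : ¬ p ∣ q)
    (hroot : ¬ IsRootedPrime p q) :
    ∃ c : Necklace p, c.length = q ∧ c.IsAperiodic ∧ ¬ c.weight ≡ 0 [MOD p] ∧
      ¬ c.IsInvertible := by
  have : Fact q.Prime := ⟨hq⟩
  have hirr := mt (isRootedPrime_of_irreducible_cyclotomic hq hpq) hroot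
  have hdeg : (cyclotomic q (ZMod p)).natDegree = q - 1 := by
    rw [natDegree_cyclotomic, Nat.totient_prime hq]
  have hu : ¬ IsUnit (cyclotomic q (ZMod p)) := by
    intro hu
    have h1 : q - 1 = 0 := hdeg ▸ natDegree_eq_zero_of_isUnit hu
    have := hq.two_le
    omega
  rw [irreducible_iff] at hirr
  push Not at hirr
  obtain ⟨g, h, hgh, hg, hh⟩ := hirr hu
  have hg0 : g ≠ 0 := by
    rintro rfl
    exact cyclotomic_ne_zero q (ZMod p) (by simpa using hgh)
  have hh0 : h ≠ 0 := by
    rintro rfl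
    exact cyclotomic_ne_zero q (ZMod p) (by simpa using hgh)
  have hhd : h.natDegree ≠ 0 := fun h0 => hh (isUnit_iff_degree_eq_zero.2 (by
    rw [degree_eq_natDegree hh0, h0]; rfl))
  have hsum := natDegree_mul hg0 hh0
  rw [← hgh, hdeg] at hsum
  refine exists_not_isInvertible_of_dvd (g := g) (by omega)
    (fun h0 => hg (isUnit_iff_degree_eq_zero.2 h0)) ?_ ?_ ?_
  · intro h1
    have h2 := eval_one_cyclotomic_prime (R := ZMod p) (p := q)
    rw [hgh, eval_mul, h1, zero_mul] at h2
    exact hpq ((ZMod.natCast_eq_zero_iff q p).1 h2.symm)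
  · rw [← cyclotomic_prime_mul_X_sub_one, hgh, mul_assoc]
    exact dvd_mul_right _ _
  · intro d hd hper
    -- Period 1 would make all coefficients equal to the one at `q - 1`, which is 0 since `g` is a
    -- proper factor of `Φ_q`.
    refine ((Nat.dvd_prime hq).1 hd).resolve_left ?_
    rintro rfl
    have hval : ∀ i, i < q → g.coeff i = g.coeff 0 := by
      intro i
      induction i with
      | zero => simp
      | succ i ih =>
        intro hi
        have := hper ⟨i, by omega⟩
        rw [← ih (by omega), ← this]
        congr 1
        simp [Fin.val_add, Nat.mod_eq_of_lt hi]
    have hlast : g.coeff (q - 1) = 0 := coeff_eq_zero_of_natDegree_lt (by omega)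
    have hlead := hval g.natDegree (by omega)
    rw [← hval (q - 1) (by omega), hlast, coeff_natDegree, leadingCoeff_eq_zero] at hlead
    exact hg0 hlead

theorem exists_not_isInvertible_of_prime_dvd {p q n : ℕ} [Fact p.Prime] (hq : q.Prime)
    (hpq : ¬ p ∣ q) (hqn : q ∣ n) (hlt : q < n) :
    ∃ c : Necklace p, c.length = n ∧ c.IsAperiodic ∧ ¬ c.weight ≡ 0 [MOD p] ∧
      ¬ c.IsInvertible := by
  have : Fact q.Prime := ⟨hq⟩
  have : NeZero n := ⟨by omega⟩
  have hq2 := hq.two_le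
  have hdeg : (cyclotomic q (ZMod p)).natDegree = q - 1 := by
    rw [natDegree_cyclotomic, Nat.totient_prime hq]
  have hcoeff : ∀ i, (cyclotomic q (ZMod p)).coeff i = if i < q then 1 else 0 := fun i => by
    rw [cyclotomic_prime, finsetSum_coeff]
    simp [coeff_X_pow]
  refine exists_not_isInvertible_of_dvd (g := cyclotomic q (ZMod p)) (by omega) ?_ ?_ ?_ ?_
  · intro h0
    have := natDegree_eq_zero_iff_degree_le_zero.2 h0.le
    omega
  · rw [eval_one_cyclotomic_prime]
    exact fun h0 => hpq ((ZMod.natCast_eq_zero_iff q p).1 h0)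
  · rw [← prod_cyclotomic_eq_X_pow_sub_one (by omega)]
    exact Finset.dvd_prod_of_mem _ (Nat.mem_divisors.2 ⟨hqn, by omega⟩)
  · intro d hd hper
    have hdn := Nat.le_of_dvd (by omega) hd
    by_contra hne
    have hd0 : 0 < d := Nat.pos_of_dvd_of_pos hd (by omega)
    have hmod : d % n = d := Nat.mod_eq_of_lt (by omega)
    -- For a period `d < n` of `1^q 0^(n-q)`, position 0 forces `d < q`, while position `n - 1`
    -- wraps to `d - 1` and compares a 1 with a 0.
    have h0 := hper 0
    have h1 := hper ⟨n - 1, by omega⟩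
    have he : (n - 1 + d) % n = d - 1 := by
      rw [show n - 1 + d = d - 1 + n by omega, Nat.add_mod_right, Nat.mod_eq_of_lt (by omega)]
    simp only [hcoeff, Fin.val_add, Fin.val_ofNat, hmod, he, Fin.val_zero, zero_add] at h0 h1
    rw [if_pos (show 0 < q by omega)] at h0
    rw [if_neg (show ¬ n - 1 < q by omega)] at h1
    have hdq : d < q := by
      by_contra hc
      rw [if_neg hc] at h0
      exact zero_ne_one h0
    rw [if_pos (by omega)] at h1
    exact one_ne_zero h1

end Necklace

theorem mainTheorem4 (p : ℕ) (hp : p.Prime) (n : ℕ) (hn : 0 < n) :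
    (∀ c : Necklace p, c.length = n → c.IsAperiodic → ¬ c.weight ≡ 0 [MOD p] → c.IsInvertible) ↔
      ((∃ k : ℕ, n = p ^ k) ∨ IsRootedPrime p n) := by
  have : Fact p.Prime := ⟨hp⟩
  have : NeZero n := ⟨hn.ne'⟩
  constructor
  · intro h
    by_contra hcon
    push Not at hcon
    obtain ⟨hpow, hroot⟩ := hcon
    obtain ⟨q, hq, hqn, hqp⟩ : ∃ q, q.Prime ∧ q ∣ n ∧ q ≠ p := by
      by_contra hc
      push Not at hc
      exact hpow _ (Nat.eq_prime_pow_of_unique_prime_dvd hn.ne' fun {d} hd hdn => hc d hd hdn)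
    have hpq : ¬ p ∣ q := fun hd => hqp ((Nat.prime_dvd_prime_iff_eq hp hq).1 hd).symm
    obtain ⟨c, hc, hap, hw, hinv⟩ : ∃ c : Necklace p, c.length = n ∧ c.IsAperiodic ∧
        ¬ c.weight ≡ 0 [MOD p] ∧ ¬ c.IsInvertible := by
      rcases (Nat.le_of_dvd hn hqn).eq_or_lt with rfl | hlt
      · exact Necklace.exists_not_isInvertible_of_prime hq hpq hroot
      · exact Necklace.exists_not_isInvertible_of_prime_dvd hq hpq hqn hlt
    exact hinv (h c hc hap hw)
  · intro h c hc hap hw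
    obtain ⟨f, rfl⟩ : ∃ f : Fin n → Fin p, c = ((List.ofFn f : List (Fin p)) : Necklace p) := by
      induction c using Quotient.inductionOn' with
      | h l =>
        subst hc
        exact ⟨l.get, congrArg _ (List.ofFn_get l).symm⟩
    rcases h with ⟨k, rfl⟩ | h
    · apply Necklace.isInvertible_of_isCoprime
      rw [Necklace.weight_ofFn_modEq_zero_iff] at hw
      exact isCoprime_X_pow_prime_pow_sub_one k hw
    · exact Necklace.isInvertible_of_isRootedPrime h hap hw
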